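/- Let $k\ge 1$. For $n\ge 1$ let $C_n(\mathbb{R}^k)$ be the space of ordered $n$-tuples $p=(p_1,\dots,p_n)$ of distinct points of $\mathbb{R}^k$. For distinct indices $i,j$ put $\pi_{ij}(p)=\frac{p_i-p_j}{\|p_i-p_j\|}\in S^{k-1}$, and for pairwise distinct indices $i,j,l$ put $r_{ijl}(p)=\frac{\|p_i-p_j\|}{\|p_i-p_l\|}\in[0,\infty]$. The compactified configuration space $C_n[\mathbb{R}^k]$ is the closure of the image of $C_n(\mathbb{R}^k)$ under $$\alpha_n=\iota\times(\pi_{ij})\times(r_{ijl})\colon C_n(\mathbb{R}^k)\to A_n[\mathbb{R}^k]=(\mathbb{R}^k)^n\times(S^{k-1})^{n(n-1)}\times[0,\infty]^{n(n-1)(n-2)},$$ where $\iota$ is the inclusion $C_n(\mathbb{R}^k)\subset(\mathbb{R}^k)^n$. It carries the smooth structure induced from $A_n[\mathbb{R}^k]$ (where $[0,\infty]$ is identified with $[0,1]$ by $r\mapsto r/(1+r)$): a map is smooth if it is locally the restriction of a smooth map in the surrounding coordinates. Let $\Delta=(p_0,\dots,p_k)$ be a non-degenerate $k$-simplex in $\mathbb{R}^k$,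 that is, an ordered $(k+1)$-tuple of affinely independent points, and let $\mathrm{Sim}(\Delta)$ be the set of all $q\in C_{k+1}(\mathbb{R}^k)$ with $r_{ijl}(q)=r_{ijl}(\Delta)$ for all pairwise distinct $i,j,l$. Let $\overline{\mathrm{Sim}}(\Delta)$ be the closure of $\alpha_{k+1}(\mathrm{Sim}(\Delta))$ in $C_{k+1}[\mathbb{R}^k]$. Then $\overline{\mathrm{Sim}}(\Delta)$ is a submanifold of $C_{k+1}[\mathbb{R}^k]$, of dimension $\frac{k(k-1)}{2}+1+k$: with $N=k(k+1)$, every point of $\overline{\mathrm{Sim}}(\Delta)$ has an open neighbourhood in $C_{k+1}[\mathbb{R}^k]$ with a diffeomorphism onto an open subset of some $\{y\in\mathbb{R}^N : y_i\ge 0 \text{ for } i\in J\}$, $J\subseteq\{1,\dots,N\}$, under which $\overline{\mathrm{Sim}}(\Delta)$ corresponds to the points with $y_i=0$ for all $i\in K$, for some $K\subseteq\{1,\dots,N\}$ disjoint from $J$ with $N-|K|=\frac{k(k-1)}{2}+1+k$. Moreover $\overline{\mathrm{Sim}}(\Delta)$ is diffeomorphic to $\mathrm{O}(k)\times[0,\infty)\times\mathbb{R}^k$.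 -/

import Mathlib

open scoped ContDiff ENNReal

noncomputable section

namespace SimplexConfig

/-! ### Smooth maps between subsets of normed spaces -/

section Smooth

variable {E F : Type*} [NormedAddCommGroup E] [NormedSpace ℝ E]
  [NormedAddCommGroup F] [NormedSpace ℝ F]

/-- A map between subsets of normed spaces is smooth if, near every point of its domain, it is the
restriction of a `C^∞` map defined on an open subset of the surrounding space. -/
def IsSmooth {X : Set E} {Y : Set F} (f : X → Y) : Prop :=
  ∀ x : X, ∃ U : Set E, IsOpen U ∧ (x : E) ∈ U ∧ ∃ g : E → F,
    ContDiffOn ℝ ∞ g U ∧ ∀ y : X, (y : E) ∈ U → (f y : F) = g y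

/-- A diffeomorphism between subsets of normed spaces: a bijection that is smooth in both
directions. -/
structure SetDiffeo (X : Set E) (Y : Set F) where
  toEquiv : X ≃ Y
  smooth_toFun : IsSmooth toEquiv
  smooth_invFun : IsSmooth toEquiv.symm

/-- The model `{y ∈ ℝ^N | y i ≥ 0 for i ∈ J}` of an `N`-manifold with boundary and corners. -/
def quadrant (N : ℕ) (J : Finset (Fin N)) : Set (Fin N → ℝ) :=
  {y | ∀ i ∈ J, 0 ≤ y i}

/-- `S ⊆ X` is a `d`-dimensional submanifold (with boundary and corners) of the `N`-dimensional
manifold with boundary and corners `X`: every point of `S` has a neighbourhood in `X` that is the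
domain of a chart of `X`, that is, of a diffeomorphism `e` onto a relatively open subset of a model
`quadrant N J`, in which `S` is cut out by the vanishing of `N - d` of the coordinates that are not
constrained to be nonnegative. In particular, the boundary of `S` is the part of `S` in
the boundary of `X`, and `S` meets the boundary of `X` transversally. -/
def IsSubmanifold (N d : ℕ) (X S : Set E) : Prop :=
  S ⊆ X ∧ ∀ x ∈ S, ∃ J K : Finset (Fin N), Disjoint J K ∧ K.card + d = N ∧
    ∃ U : Set E, IsOpen U ∧ x ∈ U ∧ ∃ W : Set (Fin N → ℝ), IsOpen W ∧
      ∃ e : SetDiffeo (X ∩ U) (quadrant N J ∩ W),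
        ∀ z : (X ∩ U : Set E), (z : E) ∈ S ↔ ∀ i ∈ K, (e.toEquiv z : Fin N → ℝ) i = 0

end Smooth

/-! ### Configuration spaces of points in `ℝ^k` and their compactifications -/

/-- Euclidean space `ℝ^k`. -/
abbrev Euc (k : ℕ) : Type := EuclideanSpace ℝ (Fin k)

/-- Ordered pairs of distinct indices. -/
abbrev Pairs (n : ℕ) : Type := {p : Fin n × Fin n // p.1 ≠ p.2}

/-- Ordered triples `(i, j, l)` of pairwise distinct indices. -/
abbrev Triples (n : ℕ) : Type :=
  {t : Fin n × Fin n × Fin n // t.1 ≠ t.2.1 ∧ t.2.1 ≠ t.2.2 ∧ t.1 ≠ t.2.2}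

/-- The open configuration space `C_n(ℝ^k)` of `n` distinct ordered points. -/
abbrev Config (k n : ℕ) : Type := {p : Fin n → Euc k // Function.Injective p}

/-- The direction `π_{ij}(p) = (p_i - p_j) / ‖p_i - p_j‖`, a point of the unit sphere. -/
def direction {k n : ℕ} (p : Config k n) (a : Pairs n) : Metric.sphere (0 : Euc k) 1 :=
  ⟨‖p.1 a.1.1 - p.1 a.1.2‖⁻¹ • (p.1 a.1.1 - p.1 a.1.2), by
    have h : p.1 a.1.1 - p.1 a.1.2 ≠ 0 := sub_ne_zero.2 fun h => a.2 (p.2 h)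
    rw [mem_sphere_zero_iff_norm, norm_smul, norm_inv, norm_norm,
      inv_mul_cancel₀ (norm_ne_zero_iff.2 h)]⟩

/-- The ratio of distances `r_{ijl}(p) = ‖p_i - p_j‖ / ‖p_i - p_l‖`. -/
def ratio {k n : ℕ} (p : Config k n) (t : Triples n) : ℝ≥0∞ :=
  ENNReal.ofReal (‖p.1 t.1.1 - p.1 t.1.2.1‖ / ‖p.1 t.1.1 - p.1 t.1.2.2‖)

/-- `A_n[ℝ^k] = (ℝ^k)^n × (S^{k-1})^{n(n-1)} × [0,∞]^{n(n-1)(n-2)}`. -/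
abbrev Ambient (k n : ℕ) : Type :=
  (Fin n → Euc k) × (Pairs n → Metric.sphere (0 : Euc k) 1) × (Triples n → ℝ≥0∞)

/-- The map `α_n = ι × (π_{ij}) × (r_{ijl}) : C_n(ℝ^k) → A_n[ℝ^k]`. -/
def alpha {k n : ℕ} (p : Config k n) : Ambient k n :=
  (p.1, direction p, ratio p)

/-- The compactified configuration space `C_n[ℝ^k]`, the closure of `α_n(C_n(ℝ^k))` in
`A_n[ℝ^k]`. -/
def compactConfig (k n : ℕ) : Set (Ambient k n) :=
  closure (Set.range alpha)

/-- The vector space that contains `A_n[ℝ^k]` as a product of submanifolds. -/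
abbrev AmbientVec (k n : ℕ) : Type :=
  (Fin n → Euc k) × (Pairs n → Euc k) × (Triples n → ℝ)

/-- The embedding of `A_n[ℝ^k]` into a vector space that gives `A_n[ℝ^k]` its smooth structure: the
sphere is included in `ℝ^k`, and `[0,∞]` is identified with `[0,1]` by `r ↦ (r⁻¹ + 1)⁻¹ = r/(1+r)`.
This is a diffeomorphism for the usual smooth structure of `[0,∞]`, in which `r` is a coordinate on
`[0,∞)` and `1/r` is a coordinate on `(0,∞]`. -/
def ambientCoord {k n : ℕ} (z : Ambient k n) : AmbientVec k n :=
  (z.1, fun a => (z.2.1 a : Euc k), fun t => (ENNReal.orderIsoUnitIntervalBirational (z.2.2 t) : ℝ))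

/-! ### Simplices similar to a given one -/

/-- A non-degenerate simplex, with its ordered vertices, as a point of `C_{k+1}(ℝ^k)`. -/
def simplexConfig {k : ℕ} (Δ : Affine.Simplex ℝ (Euc k) k) : Config k (k + 1) :=
  ⟨Δ.points, Δ.independent.injective⟩

/-- `Sim(Δ)`, the set of configurations with the same ratios of distances as `Δ`. -/
def Sim {k : ℕ} (Δ : Affine.Simplex ℝ (Euc k) k) : Set (Config k (k + 1)) :=
  {q | ∀ t : Triples (k + 1), ratio q t = ratio (simplexConfig Δ) t}

/-- The closure of `Sim(Δ)` in `C_{k+1}[ℝ^k]`. (As `C_{k+1}[ℝ^k]` is closed in `A_{k+1}[ℝ^k]`, it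
is the closure in `A_{k+1}[ℝ^k]`.) -/
def simClosure {k : ℕ} (Δ : Affine.Simplex ℝ (Euc k) k) : Set (Ambient k (k + 1)) :=
  closure (alpha '' Sim Δ)

/-- The orthogonal group `O(k)` as a subset of the vector space of `k × k` matrices. -/
def orthogonalMatrices (k : ℕ) : Set (Fin k → Fin k → ℝ) :=
  {A | Matrix.of A ∈ Matrix.orthogonalGroup (Fin k) ℝ}

end SimplexConfig

end

/-!
Where all ratios of distances are finite and non-zero, a point of `C_{n+1}[ℝ^k]` is determined by
its first vertex, the distance `t ≥ 0` of its first two vertices, and the edge vectors at the first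
vertex, rescaled so that the first of them has length `1`. The rescaled edge vectors are functions
of the directions and ratios only, and so make sense for `t = 0`, when all points collide. In these
coordinates the closure of `Sim(Δ)` consists of the points whose rescaled edge vectors have the same
Gram matrix as those of `Δ`, while `t` and the first vertex are arbitrary. The bases of `ℝ^k` with a
given Gram matrix form an orbit of `O(k)`, which the entries of the Gram matrix on and above the
diagonal cut out transversally: at a basis `b`, these entries and the skew part of the matrix of
inner products with `b` form a local coordinate system.
-/

noncomputable section

namespace SimplexConfig

/-! ### Diffeomorphisms and submanifolds -/

section Smooth

variable {E F G : Type*} [NormedAddCommGroup E] [NormedSpace ℝ E]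
  [NormedAddCommGroup F] [NormedSpace ℝ F] [NormedAddCommGroup G] [NormedSpace ℝ G]
  {X : Set E} {Y : Set F} {Z : Set G}

namespace IsSmooth

theorem of_contDiffOn {f : X → Y} {g : E → F} {U : Set E} (hU : IsOpen U) (hXU : X ⊆ U)
    (hg : ContDiffOn ℝ ∞ g U) (h : ∀ x : X, (f x : F) = g x) : IsSmooth f :=
  fun x => ⟨U, hU, hXU x.2, g, hg, fun y _ => h y⟩

theorem continuous {f : X → Y} (hf : IsSmooth f) : Continuous f := by
  refine continuous_iff_continuousAt.2 fun x => ?_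
  obtain ⟨U, hU, hxU, g, hg, hfg⟩ := hf x
  have hgx : ContinuousAt (fun y : X => g y) x :=
    (hg.continuousOn.continuousAt (hU.mem_nhds hxU)).comp continuousAt_subtype_val
  refine Topology.IsInducing.subtypeVal.continuousAt_iff.2 (hgx.congr ?_)
  filter_upwards [continuousAt_subtype_val (hU.mem_nhds hxU)] with y hy using (hfg y hy).symm

theorem comp {g : Y → Z} {f : X → Y} (hg : IsSmooth g) (hf : IsSmooth f) :
    IsSmooth (g ∘ f) := by
  intro x
  obtain ⟨U, hU, hxU, f', hf', hff'⟩ := hf x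
  obtain ⟨V, hV, hxV, g', hg', hgg'⟩ := hg (f x)
  refine ⟨U ∩ f' ⁻¹' V, hf'.continuousOn.isOpen_inter_preimage hU hV,
    ⟨hxU, by rwa [Set.mem_preimage, ← hff' x hxU]⟩, g' ∘ f',
    hg'.comp (hf'.mono Set.inter_subset_left) fun y hy => hy.2, fun y hy => ?_⟩
  have hfy : (f y : F) = f' y := hff' y hy.1
  rw [Function.comp_apply, Function.comp_apply, ← hfy]
  exact hgg' (f y) (by rw [hfy]; exact hy.2)

theorem prodMap {H : Type*} [NormedAddCommGroup H] [NormedSpace ℝ H] {W : Set H}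
    {f : X → Y} {g : Z → W} (hf : IsSmooth f) (hg : IsSmooth g) :
    IsSmooth fun x : (X ×ˢ Z : Set (E × G)) =>
      (⟨(f ⟨x.1.1, x.2.1⟩, g ⟨x.1.2, x.2.2⟩), ⟨(f _).2, (g _).2⟩⟩ : (Y ×ˢ W : Set (F × H))) := by
  intro x
  obtain ⟨U, hU, hxU, f', hf', hff'⟩ := hf ⟨x.1.1, x.2.1⟩
  obtain ⟨V, hV, hxV, g', hg', hgg'⟩ := hg ⟨x.1.2, x.2.2⟩
  exact ⟨U ×ˢ V, hU.prod hV, ⟨hxU, hxV⟩, Prod.map f' g', hf'.prodMap hg',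
    fun y hy => Prod.ext (hff' _ hy.1) (hgg' _ hy.2)⟩

theorem restrict {f : X → Y} (hf : IsSmooth f) {A : Set E} {B : Set F} (hA : A ⊆ X)
    (hB : ∀ x : A, (f ⟨x, hA x.2⟩ : F) ∈ B) :
    IsSmooth fun x : A => (⟨f ⟨x, hA x.2⟩, hB x⟩ : B) := by
  intro x
  obtain ⟨U, hU, hxU, g, hg, hfg⟩ := hf ⟨x, hA x.2⟩
  exact ⟨U, hU, hxU, g, hg, fun y hy => hfg ⟨y, hA y.2⟩ hy⟩

end IsSmooth

namespace SetDiffeo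

/-- The diffeomorphism given by two maps that are smooth on open neighbourhoods of `X` and `Y` and
restrict to mutually inverse maps between `X` and `Y`. -/
def ofMaps (f : E → F) (g : F → E) {U : Set E} {V : Set F}
    (hU : IsOpen U) (hXU : X ⊆ U) (hf : ContDiffOn ℝ ∞ f U)
    (hV : IsOpen V) (hYV : Y ⊆ V) (hg : ContDiffOn ℝ ∞ g V)
    (hfX : Set.MapsTo f X Y) (hgY : Set.MapsTo g Y X) (hinv : Set.InvOn g f X Y) :
    SetDiffeo X Y where
  toEquiv :=
    { toFun := fun x => ⟨f x, hfX x.2⟩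
      invFun := fun y => ⟨g y, hgY y.2⟩
      left_inv := fun x => Subtype.ext (hinv.1 x.2)
      right_inv := fun y => Subtype.ext (hinv.2 y.2) }
  smooth_toFun := .of_contDiffOn hU hXU hf fun _ => rfl
  smooth_invFun := .of_contDiffOn hV hYV hg fun _ => rfl

/-- The identity as a diffeomorphism. -/
def refl (X : Set E) : SetDiffeo X X :=
  ofMaps id id isOpen_univ (Set.subset_univ X) contDiffOn_id isOpen_univ (Set.subset_univ X)
    contDiffOn_id (Set.mapsTo_id X) (Set.mapsTo_id X) ⟨fun _ _ => rfl, fun _ _ => rfl⟩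

/-- The composition of two diffeomorphisms. -/
def trans (e : SetDiffeo X Y) (e' : SetDiffeo Y Z) : SetDiffeo X Z where
  toEquiv := e.toEquiv.trans e'.toEquiv
  smooth_toFun := e'.smooth_toFun.comp e.smooth_toFun
  smooth_invFun := e.smooth_invFun.comp e'.smooth_invFun

/-- The product of two diffeomorphisms. -/
def prodCongr {H : Type*} [NormedAddCommGroup H] [NormedSpace ℝ H] {W : Set H}
    (e : SetDiffeo X Y) (e' : SetDiffeo Z W) : SetDiffeo (X ×ˢ Z) (Y ×ˢ W) where
  toEquiv :=
    { toFun := fun x => ⟨(e.toEquiv ⟨x.1.1, x.2.1⟩, e'.toEquiv ⟨x.1.2, x.2.2⟩),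
        ⟨(e.toEquiv _).2, (e'.toEquiv _).2⟩⟩
      invFun := fun y => ⟨(e.toEquiv.symm ⟨y.1.1, y.2.1⟩, e'.toEquiv.symm ⟨y.1.2, y.2.2⟩),
        ⟨(e.toEquiv.symm _).2, (e'.toEquiv.symm _).2⟩⟩
      left_inv := fun x => by simp
      right_inv := fun y => by simp }
  smooth_toFun := e.smooth_toFun.prodMap e'.smooth_toFun
  smooth_invFun := e.smooth_invFun.prodMap e'.smooth_invFun

/-- The restriction of a diffeomorphism to subsets that correspond to each other. -/
def restrict (e : SetDiffeo X Y) {A : Set E} {B : Set F} (hA : A ⊆ X) (hB : B ⊆ Y)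
    (h : ∀ x : X, (x : E) ∈ A ↔ (e.toEquiv x : F) ∈ B) : SetDiffeo A B where
  toEquiv :=
    { toFun := fun x => ⟨e.toEquiv ⟨x, hA x.2⟩, (h _).1 x.2⟩
      invFun := fun y => ⟨e.toEquiv.symm ⟨y, hB y.2⟩, (h _).2 (by simp)⟩
      left_inv := fun x => by simp
      right_inv := fun y => by simp }
  smooth_toFun := e.smooth_toFun.restrict hA _
  smooth_invFun := e.smooth_invFun.restrict hB _

/-- Concatenation of tuples, as a diffeomorphism. -/
def finAppend {m n : ℕ} (A : Set (Fin m → ℝ)) (B : Set (Fin n → ℝ)) :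
    SetDiffeo (A ×ˢ B) {y : Fin (m + n) → ℝ |
      (fun i => y (Fin.castAdd n i)) ∈ A ∧ (fun i => y (Fin.natAdd m i)) ∈ B} :=
  ofMaps (fun x => Fin.append x.1 x.2)
    (fun y => (fun i => y (Fin.castAdd n i), fun i => y (Fin.natAdd m i)))
    isOpen_univ (Set.subset_univ _)
    (contDiff_pi.2 fun i => i.addCases (by simp only [Fin.append_left]; fun_prop)
      (by simp only [Fin.append_right]; fun_prop)).contDiffOn
    isOpen_univ (Set.subset_univ _) (by fun_prop)
    (fun x hx => by simpa using hx) (fun y hy => hy)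
    ⟨fun x _ => by simp, fun y _ => Fin.append_castAdd_natAdd⟩

end SetDiffeo

namespace IsSubmanifold

/-- The subset of `Fin (m + n)` that consists of `J`, in the first `m` places, and `J'`, in the last
`n` places. -/
def finsetAppend {m n : ℕ} (J : Finset (Fin m)) (J' : Finset (Fin n)) : Finset (Fin (m + n)) :=
  (J.disjSum J').map finSumFinEquiv.toEmbedding

theorem forall_mem_finsetAppend {m n : ℕ} {J : Finset (Fin m)} {J' : Finset (Fin n)}
    {p : Fin (m + n) → Prop} : (∀ i ∈ finsetAppend J J', p i) ↔
      (∀ i ∈ J, p (Fin.castAdd n i)) ∧ ∀ i ∈ J', p (Fin.natAdd m i) := by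
  simp only [finsetAppend, Finset.forall_mem_map, Equiv.coe_toEmbedding, Sum.forall,
    Finset.inl_mem_disjSum, Finset.inr_mem_disjSum, finSumFinEquiv_apply_left,
    finSumFinEquiv_apply_right]

theorem disjoint_finsetAppend {m n : ℕ} {J K : Finset (Fin m)} {J' K' : Finset (Fin n)}
    (h : Disjoint J K) (h' : Disjoint J' K') :
    Disjoint (finsetAppend J J') (finsetAppend K K') := by
  rw [Finset.disjoint_left] at h h' ⊢
  exact forall_mem_finsetAppend.2 ⟨fun i hi => by simpa [finsetAppend] using h hi,
    fun i hi => by simpa [finsetAppend] using h' hi⟩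

variable {N N' d d' : ℕ} {S : Set E} {T : Set F}

theorem of_inter_isOpen {O : Set E} (hO : IsOpen O) (hSO : S ⊆ O)
    (h : IsSubmanifold N d (X ∩ O) S) : IsSubmanifold N d X S := by
  refine ⟨h.1.trans Set.inter_subset_left, fun x hx => ?_⟩
  obtain ⟨J, K, hJK, hK, U, hU, hxU, hchart⟩ := h.2 x hx
  rw [Set.inter_assoc] at hchart
  exact ⟨J, K, hJK, hK, O ∩ U, hO.inter hU, ⟨hSO hx, hxU⟩, hchart⟩

theorem of_setDiffeo (e : SetDiffeo X Y) (hSX : S ⊆ X)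
    (hST : ∀ x : X, (x : E) ∈ S ↔ (e.toEquiv x : F) ∈ T) (hT : IsSubmanifold N d Y T) :
    IsSubmanifold N d X S := by
  refine ⟨hSX, fun x hx => ?_⟩
  obtain ⟨J, K, hJK, hK, V, hV, hxV, W, hW, e', he'⟩ :=
    hT.2 (e.toEquiv ⟨x, hSX hx⟩) ((hST _).1 hx)
  have hpre : IsOpen {z : X | (e.toEquiv z : F) ∈ V} :=
    hV.preimage (continuous_subtype_val.comp e.smooth_toFun.continuous)
  obtain ⟨U, hU, hUV⟩ := isOpen_induced_iff.1 hpre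
  have hmem (z : X) : (z : E) ∈ U ↔ (e.toEquiv z : F) ∈ V := Set.ext_iff.1 hUV z
  let eU : SetDiffeo (X ∩ U) (Y ∩ V) := e.restrict Set.inter_subset_left Set.inter_subset_left
    fun z => by simp [hmem]
  exact ⟨J, K, hJK, hK, U, hU, (hmem ⟨x, hSX hx⟩).2 hxV, W, hW, eU.trans e',
    fun z => (hST ⟨z, z.2.1⟩).trans (he' (eU.toEquiv z))⟩

theorem prod (hS : IsSubmanifold N d X S) (hT : IsSubmanifold N' d' Y T) :
    IsSubmanifold (N + N') (d + d') (X ×ˢ Y) (S ×ˢ T) := by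
  refine ⟨Set.prod_mono hS.1 hT.1, fun x hx => ?_⟩
  obtain ⟨J, K, hJK, hK, U, hU, hxU, W, hW, e, he⟩ := hS.2 x.1 hx.1
  obtain ⟨J', K', hJK', hK', U', hU', hxU', W', hW', e', he'⟩ := hT.2 x.2 hx.2
  have hWW' : IsOpen {y : Fin (N + N') → ℝ |
      (fun i => y (Fin.castAdd N' i)) ∈ W ∧ (fun i => y (Fin.natAdd N i)) ∈ W'} :=
    (hW.preimage (by fun_prop)).inter (hW'.preimage (by fun_prop))
  have hquadrant : quadrant (N + N') (finsetAppend J J') ∩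
      {y | (fun i => y (Fin.castAdd N' i)) ∈ W ∧ (fun i => y (Fin.natAdd N i)) ∈ W'} =
      {y | (fun i => y (Fin.castAdd N' i)) ∈ quadrant N J ∩ W ∧
        (fun i => y (Fin.natAdd N i)) ∈ quadrant N' J' ∩ W'} := by
    ext y
    simp only [quadrant, forall_mem_finsetAppend, Set.mem_inter_iff, Set.mem_ofPred_eq,
      and_and_and_comm]
  refine ⟨finsetAppend J J', finsetAppend K K', ?_, ?_, U ×ˢ U', hU.prod hU', ⟨hxU, hxU'⟩, _,
    hWW', ?_⟩
  · exact disjoint_finsetAppend hJK hJK'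
  · simp only [finsetAppend, Finset.card_map, Finset.card_disjSum]
    omega
  · rw [Set.prod_inter_prod, hquadrant]
    refine ⟨(e.prodCongr e').trans (.finAppend _ _), fun z => ?_⟩
    rw [forall_mem_finsetAppend, Set.mem_prod, he ⟨z.1.1, z.2.1⟩, he' ⟨z.1.2, z.2.2⟩]
    simp [SetDiffeo.trans, SetDiffeo.finAppend, SetDiffeo.ofMaps, SetDiffeo.prodCongr]

end IsSubmanifold

theorem exists_openPartialHomeomorph_contDiffOn_symm [CompleteSpace E] {n : WithTop ℕ∞}
    (hn : n ≠ 0) {f : E → F} (hf : ContDiff ℝ n f) {a : E} {f' : E ≃L[ℝ] F}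
    (hf' : HasFDerivAt f (f' : E →L[ℝ] F) a) {O : Set E} (hO : IsOpen O) (ha : a ∈ O) :
    ∃ e : OpenPartialHomeomorph E F, ⇑e = f ∧ a ∈ e.source ∧ e.source ⊆ O ∧
      ContDiffOn ℝ n e.symm e.target := by
  let O' : Set E := O ∩ fderiv ℝ f ⁻¹' Set.range ((↑) : (E ≃L[ℝ] F) → E →L[ℝ] F)
  have hO' : IsOpen O' :=
    hO.inter (ContinuousLinearEquiv.isOpen.preimage (hf.continuous_fderiv hn))
  let e := (hf.contDiffAt.toOpenPartialHomeomorph f hf' hn).restrOpen O' hO'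
  refine ⟨e, rfl, ⟨hf.contDiffAt.mem_toOpenPartialHomeomorph_source hf' hn, ha, f',
    hf'.fderiv.symm⟩, fun x hx => hx.2.1, fun y hy => ?_⟩
  obtain ⟨g', hg'⟩ := (e.map_target hy).2.2
  refine (e.contDiffAt_symm hy (f₀' := g') ?_ hf.contDiffAt).contDiffWithinAt
  rw [hg']
  exact (hf.differentiable hn _).hasFDerivAt

namespace IsSubmanifold

/-- The vector with coordinates `y` outside `C` and coordinates `0` in `C`, where `σ` numbers the
indices outside `C`. -/
def zeroExtend {ι : Type*} [DecidableEq ι] {C : Finset ι} {N : ℕ} (σ : {i // i ∉ C} ≃ Fin N)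
    (y : Fin N → ℝ) (i : ι) : ℝ :=
  if hi : i ∈ C then 0 else y (σ ⟨i, hi⟩)

section zeroExtend

variable {ι : Type*} [DecidableEq ι] {C : Finset ι} (σ : {i // i ∉ C} ≃ Fin N)

theorem zeroExtend_of_mem {i : ι} (hi : i ∈ C) (y : Fin N → ℝ) : zeroExtend σ y i = 0 :=
  dif_pos hi

theorem zeroExtend_symm (y : Fin N → ℝ) (n : Fin N) : zeroExtend σ y (σ.symm n) = y n := by
  simp [zeroExtend, (σ.symm n).2]

theorem zeroExtend_comp {x : ι → ℝ} (hx : ∀ i ∈ C, x i = 0) :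
    zeroExtend σ (fun n => x (σ.symm n)) = x := by
  ext i
  by_cases hi : i ∈ C <;> simp [zeroExtend, hi, hx]

theorem contDiff_zeroExtend [Fintype ι] : ContDiff ℝ ∞ (zeroExtend σ) :=
  contDiff_pi.2 fun i => by
    by_cases hi : i ∈ C <;> simp only [zeroExtend, hi, dite_true, dite_false] <;> fun_prop

/-- If a local diffeomorphism `e` maps `X` to the points whose coordinates in `C` vanish, then the
remaining coordinates are a chart of `X`. -/
def chartOfVanishing [Fintype ι] (e : OpenPartialHomeomorph E (ι → ℝ))
    (he : ContDiffOn ℝ ∞ e e.source) (hesymm : ContDiffOn ℝ ∞ e.symm e.target)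
    (hX : ∀ x ∈ e.source, x ∈ X ↔ ∀ i ∈ C, e x i = 0) :
    SetDiffeo (X ∩ e.source) (quadrant N ∅ ∩ zeroExtend σ ⁻¹' e.target) :=
  have hext {x : E} (hx : x ∈ X ∩ e.source) : zeroExtend σ (fun n => e x (σ.symm n)) = e x :=
    zeroExtend_comp σ ((hX x hx.2).1 hx.1)
  .ofMaps (fun x n => e x (σ.symm n)) (e.symm ∘ zeroExtend σ) e.open_source Set.inter_subset_right
    (contDiffOn_pi.2 fun n => contDiffOn_pi.1 he (σ.symm n))
    (e.open_target.preimage (contDiff_zeroExtend σ).continuous) Set.inter_subset_right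
    (hesymm.comp (contDiff_zeroExtend σ).contDiffOn fun _ hy => hy)
    (fun x hx => ⟨by simp [quadrant], by
      rw [Set.mem_preimage, hext hx]
      exact e.map_source hx.2⟩)
    (fun y hy => ⟨(hX _ (e.map_target hy.2)).2 fun i hi => by
      rw [e.right_inv hy.2, zeroExtend_of_mem σ hi], e.map_target hy.2⟩)
    ⟨fun x hx => by rw [Function.comp_apply, hext hx, e.left_inv hx.2],
      fun y hy => funext fun n => by
        dsimp only [Function.comp_apply]
        rw [e.right_inv hy.2, zeroExtend_symm]⟩

end zeroExtend

theorem of_coordinates [CompleteSpace E] {ι : Type*} [Fintype ι] {C K : Finset ι}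
    (hCK : Disjoint C K) (hN : C.card + N = Fintype.card ι) (hd : K.card + d = N) (hSX : S ⊆ X)
    (h : ∀ a ∈ S, ∃ (f : E → ι → ℝ) (f' : E ≃L[ℝ] (ι → ℝ)) (O : Set E), ContDiff ℝ ∞ f ∧
      HasFDerivAt f (f' : E →L[ℝ] (ι → ℝ)) a ∧ IsOpen O ∧ a ∈ O ∧
      (∀ x ∈ O, x ∈ X ↔ ∀ i ∈ C, f x i = 0) ∧ ∀ x ∈ X ∩ O, x ∈ S ↔ ∀ i ∈ K, f x i = 0) :
    IsSubmanifold N d X S := by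
  classical
  refine ⟨hSX, fun a ha => ?_⟩
  obtain ⟨f, f', O, hf, hf', hO, haO, hX, hS⟩ := h a ha
  obtain ⟨e, rfl, hae, heO, hesymm⟩ :=
    exists_openPartialHomeomorph_contDiffOn_symm (by simp) hf hf' hO haO
  have hCcard : Fintype.card {i // i ∉ C} = N := by
    rw [Fintype.card_subtype_compl, Fintype.card_coe]
    omega
  have hKC : ∀ i ∈ K, i ∉ C := fun i hiK hiC => Finset.disjoint_left.1 hCK hiC hiK
  let σ : {i // i ∉ C} ≃ Fin N := Fintype.equivFinOfCardEq hCcard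
  let K' : Finset (Fin N) := (K.subtype (· ∉ C)).map σ.toEmbedding
  have hK' : K'.card = K.card := by
    rw [Finset.card_map, Finset.card_subtype, Finset.filter_true_of_mem hKC]
  refine ⟨∅, K', Finset.disjoint_empty_left _, hK' ▸ hd, e.source, e.open_source, hae, _,
    e.open_target.preimage (contDiff_zeroExtend σ).continuous,
    chartOfVanishing σ e hf.contDiffOn hesymm fun x hx => hX x (heO hx), fun z => ?_⟩
  rw [hS z ⟨z.2.1, heO z.2.2⟩]
  simp only [K', chartOfVanishing, SetDiffeo.ofMaps, Finset.forall_mem_map, Finset.mem_subtype,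
    Equiv.coe_toEmbedding, Equiv.coe_fn_mk, Equiv.symm_apply_apply, Subtype.forall]
  exact ⟨fun h i _ hi => h i hi, fun h i hi => h i (hKC i hi) hi⟩

theorem Ici_zero : IsSubmanifold 1 1 (Set.Ici (0 : ℝ)) (Set.Ici 0) := by
  refine ⟨subset_rfl, fun x _ => ⟨{0}, ∅, by simp, by simp, Set.univ, isOpen_univ, trivial,
    Set.univ, isOpen_univ, ?_⟩⟩
  exact ⟨.ofMaps (fun t _ => t) (fun y => y 0) isOpen_univ (Set.subset_univ _) (by fun_prop)
    isOpen_univ (Set.subset_univ _) (by fun_prop) (fun t ht => ⟨fun _ _ => ht.1, trivial⟩)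
    (fun y hy => ⟨hy.1 0 (by simp), trivial⟩)
    ⟨fun _ _ => rfl, fun y _ => funext fun i => by rw [Fin.fin_one_eq_zero i]⟩,
    fun z => by simpa using z.2.1⟩

theorem univ [FiniteDimensional ℝ E] :
    IsSubmanifold (Module.finrank ℝ E) (Module.finrank ℝ E) (Set.univ : Set E) Set.univ :=
  have : CompleteSpace E := FiniteDimensional.complete ℝ E
  let L := (Module.finBasis ℝ E).equivFunL
  of_coordinates (C := ∅) (K := ∅) (by simp) (by simp) (by simp) subset_rfl fun _ _ =>
    ⟨L, L, Set.univ, L.contDiff, L.hasFDerivAt, isOpen_univ, trivial, by simp, by simp⟩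

end IsSubmanifold

end Smooth

/-! ### Families of vectors with a given Gram matrix -/

section Gram

variable {V ι : Type*} [NormedAddCommGroup V] [InnerProductSpace ℝ V]

/-- The families of vectors with the same Gram matrix as `B₀`. -/
def gramFiber (B₀ : ι → V) : Set (ι → V) := {B | Matrix.gram ℝ B = Matrix.gram ℝ B₀}

theorem mem_gramFiber {B B₀ : ι → V} :
    B ∈ gramFiber B₀ ↔ ∀ i j, inner ℝ (B i) (B j) = inner ℝ (B₀ i) (B₀ j) := by
  simp only [gramFiber, Set.mem_ofPred_eq, ← Matrix.ext_iff, Matrix.gram_apply]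

theorem norm_eq_of_mem_gramFiber {B B₀ : ι → V} (h : B ∈ gramFiber B₀) (i : ι) :
    ‖B i‖ = ‖B₀ i‖ := by
  rw [norm_eq_sqrt_real_inner, norm_eq_sqrt_real_inner, mem_gramFiber.1 h]

theorem linearIndependent_of_mem_gramFiber [Finite ι] {B B₀ : ι → V} (hB₀ : LinearIndependent ℝ B₀)
    (h : B ∈ gramFiber B₀) : LinearIndependent ℝ B := by
  rw [← Matrix.posDef_gram_iff_linearIndependent] at hB₀ ⊢
  rwa [h]

variable [LinearOrder ι]

/-- Coordinates on families of vectors near a basis `B₀`: on and above the diagonal, the entries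
of the Gram matrix relative to those of `B₀`, and below the diagonal the skew part of the matrix of
inner products with `B₀`. -/
def gramCoord (B₀ B : ι → V) : ι × ι → ℝ := fun p =>
  if p.1 ≤ p.2 then inner ℝ (B p.1) (B p.2) - inner ℝ (B₀ p.1) (B₀ p.2)
  else inner ℝ (B p.1) (B₀ p.2) - inner ℝ (B₀ p.1) (B p.2)

theorem mem_gramFiber_iff_gramCoord {B B₀ : ι → V} :
    B ∈ gramFiber B₀ ↔ ∀ p : ι × ι, p.1 ≤ p.2 → gramCoord B₀ B p = 0 := by
  rw [mem_gramFiber]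
  refine ⟨fun h p hp => by rw [gramCoord, if_pos hp, h, sub_self], fun h => ?_⟩
  have hle {i j : ι} (hij : i ≤ j) : inner ℝ (B i) (B j) = inner ℝ (B₀ i) (B₀ j) := by
    simpa [gramCoord, hij, sub_eq_zero] using h (i, j) hij
  intro i j
  rcases le_total i j with hij | hji
  · exact hle hij
  · rw [real_inner_comm, hle hji, real_inner_comm]

theorem gramCoord_diag_eq_zero_iff {B B₀ : ι → V} {i : ι} :
    gramCoord B₀ B (i, i) = 0 ↔ ‖B i‖ = ‖B₀ i‖ := by
  rw [gramCoord, if_pos le_rfl, sub_eq_zero, real_inner_self_eq_norm_sq, real_inner_self_eq_norm_sq,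
    sq_eq_sq₀ (norm_nonneg _) (norm_nonneg _)]

/-- The derivative of `gramCoord B₀` at `B₀`. -/
def gramCoordDeriv (B₀ : ι → V) : (ι → V) →L[ℝ] (ι × ι → ℝ) :=
  ContinuousLinearMap.pi fun p =>
    if p.1 ≤ p.2 then (innerSL ℝ (B₀ p.2)).comp (ContinuousLinearMap.proj p.1) +
      (innerSL ℝ (B₀ p.1)).comp (ContinuousLinearMap.proj p.2)
    else (innerSL ℝ (B₀ p.2)).comp (ContinuousLinearMap.proj p.1) -
      (innerSL ℝ (B₀ p.1)).comp (ContinuousLinearMap.proj p.2)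

/-- The symmetric and the skew part of the matrix of inner products of `H` with the basis vanish. -/
theorem gramCoordDeriv_injective (b : Module.Basis ι ℝ V) :
    Function.Injective (gramCoordDeriv b) := by
  refine (injective_iff_map_eq_zero _).2 fun H hH => ?_
  have hsymm {i j : ι} (h : i ≤ j) : inner ℝ (b j) (H i) + inner ℝ (b i) (H j) = 0 := by
    simpa [gramCoordDeriv, h] using congrFun hH (i, j)
  have hskew {i j : ι} (h : j < i) : inner ℝ (b j) (H i) - inner ℝ (b i) (H j) = 0 := by
    simpa [gramCoordDeriv, h.not_ge] using congrFun hH (i, j)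
  refine funext fun i => InnerProductSpace.ext_inner_left_basis (𝕜 := ℝ) b fun j => ?_
  rw [Pi.zero_apply, inner_zero_right]
  rcases lt_trichotomy i j with h | rfl | h
  · linarith [hsymm h.le, hskew h]
  · linarith [hsymm (le_refl i)]
  · linarith [hsymm h.le, hskew h]

theorem hasFDerivAt_gramCoord [Finite ι] (B₀ : ι → V) :
    HasFDerivAt (gramCoord B₀) (gramCoordDeriv B₀) B₀ := by
  have := Fintype.ofFinite ι
  refine hasFDerivAt_pi.2 fun p => ?_
  have hproj (i : ι) : HasFDerivAt (fun B : ι → V => B i)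
      (ContinuousLinearMap.proj i : (ι → V) →L[ℝ] V) B₀ := hasFDerivAt_apply i B₀
  unfold gramCoord
  split_ifs with h
  · convert! ((hproj p.1).inner ℝ (hproj p.2)).sub_const (inner ℝ (B₀ p.1) (B₀ p.2)) using 1
    ext H
    simp [real_inner_comm, add_comm]
  · convert! ((hproj p.1).inner ℝ (hasFDerivAt_const (B₀ p.2) B₀)).sub
      ((hasFDerivAt_const (B₀ p.1) B₀).inner ℝ (hproj p.2)) using 1
    ext H
    simp [real_inner_comm]

variable [Fintype ι]

theorem contDiff_gramCoord (B₀ : ι → V) {n : WithTop ℕ∞} : ContDiff ℝ n (gramCoord B₀) := by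
  refine contDiff_pi.2 fun p => ?_
  unfold gramCoord
  split_ifs
  · exact ((contDiff_apply ℝ V p.1).inner ℝ (contDiff_apply ℝ V p.2)).sub contDiff_const
  · exact ((contDiff_apply ℝ V p.1).inner ℝ contDiff_const).sub
      (contDiff_const.inner ℝ (contDiff_apply ℝ V p.2))

/-- The derivative of `gramCoord b` at the basis `b`, as an isomorphism. -/
def gramCoordEquiv [FiniteDimensional ℝ V] (b : Module.Basis ι ℝ V) :
    (ι → V) ≃L[ℝ] (ι × ι → ℝ) :=
  (LinearEquiv.ofInjectiveOfFinrankEq (gramCoordDeriv b).toLinearMap (gramCoordDeriv_injective b)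
    (by simp [Module.finrank_pi_fintype, Module.finrank_eq_card_basis b])).toContinuousLinearEquiv

theorem hasFDerivAt_gramCoord_basis [FiniteDimensional ℝ V] (b : Module.Basis ι ℝ V) :
    HasFDerivAt (gramCoord b) (gramCoordEquiv b : (ι → V) →L[ℝ] (ι × ι → ℝ)) b :=
  hasFDerivAt_gramCoord b

theorem card_filter_le (ι : Type*) [LinearOrder ι] [Fintype ι] :
    (Finset.univ.filter fun p : ι × ι => p.1 ≤ p.2).card = (Fintype.card ι + 1).choose 2 := by
  rw [← Fintype.card_subtype, ← Fintype.card_congr Sym2.sortEquiv, Sym2.card]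

theorem two_mul_choose_two_add_self (n : ℕ) : 2 * n.choose 2 + n = n * n := by
  rw [Nat.choose_two_right, Nat.mul_div_cancel' (Nat.even_mul_pred_self n).two_dvd]
  cases n <;> simp [Nat.mul_succ]

theorem isSubmanifold_gramFiber [FiniteDimensional ℝ V] {B₀ : ι → V}
    (hB₀ : LinearIndependent ℝ B₀) (hcard : Fintype.card ι = Module.finrank ℝ V) (i₀ : ι)
    {O : Set (ι → V)} (hO : IsOpen O) (hSO : gramFiber B₀ ⊆ O) :
    IsSubmanifold (Fintype.card ι * Fintype.card ι - 1) ((Fintype.card ι).choose 2)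
      ({B | ‖B i₀‖ = ‖B₀ i₀‖} ∩ O) (gramFiber B₀) := by
  have : Nonempty ι := ⟨i₀⟩
  have hpos : 0 < Fintype.card ι := Fintype.card_pos
  have : CompleteSpace V := FiniteDimensional.complete ℝ V
  let upper : Finset (ι × ι) := Finset.univ.filter fun p => p.1 ≤ p.2
  have hmem : (i₀, i₀) ∈ upper := by simp [upper]
  have hupper : upper.card = Fintype.card ι + (Fintype.card ι).choose 2 := by
    rw [card_filter_le, Nat.choose_succ_succ' _ 1, Nat.choose_one_right]
  refine .of_coordinates (C := {(i₀, i₀)}) (K := upper.erase (i₀, i₀)) (by simp) ?_ ?_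
    (fun B hB => ⟨norm_eq_of_mem_gramFiber hB i₀, hSO hB⟩) fun a ha => ?_
  · rw [Finset.card_singleton, Fintype.card_prod]
    have := Nat.mul_pos hpos hpos
    omega
  · rw [Finset.card_erase_of_mem hmem, hupper, ← two_mul_choose_two_add_self]
    omega
  · let b : Module.Basis ι ℝ V :=
      basisOfLinearIndependentOfCardEqFinrank (linearIndependent_of_mem_gramFiber hB₀ ha) hcard
    have hb : ⇑b = a := coe_basisOfLinearIndependentOfCardEqFinrank _ hcard
    have hab : gramFiber B₀ = gramFiber a := by
      rw [gramFiber, gramFiber, show Matrix.gram ℝ a = Matrix.gram ℝ B₀ from ha]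
    have hnorm : ‖a i₀‖ = ‖B₀ i₀‖ := norm_eq_of_mem_gramFiber ha i₀
    refine ⟨gramCoord a, gramCoordEquiv b, O, contDiff_gramCoord a,
      hb ▸ hasFDerivAt_gramCoord_basis b, hO, hSO ha, fun B hB => ?_, fun B hB => ?_⟩
    · simp [hB, gramCoord_diag_eq_zero_iff, hnorm]
    · have hdiag : gramCoord a B (i₀, i₀) = 0 :=
        gramCoord_diag_eq_zero_iff.2 (hB.1.1.trans hnorm.symm)
      rw [hab, mem_gramFiber_iff_gramCoord]
      refine ⟨fun h p hp => h p (by simpa [upper] using Finset.mem_of_mem_erase hp),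
        fun h p hp => ?_⟩
      by_cases hpi : p = (i₀, i₀)
      · rw [hpi, hdiag]
      · exact h p (by simp [upper, hpi, hp])

/-- The square matrix whose columns are the given vectors. -/
def columnMatrix (k : ℕ) : (Fin k → Euc k) ≃ Matrix (Fin k) (Fin k) ℝ where
  toFun B := Matrix.of fun a i => B i a
  invFun M i := WithLp.toLp 2 fun a => M a i
  left_inv _ := rfl
  right_inv _ := rfl

@[simp]
theorem columnMatrix_apply {k : ℕ} (B : Fin k → Euc k) (a i : Fin k) :
    columnMatrix k B a i = B i a := rfl

@[simp]
theorem columnMatrix_symm_apply {k : ℕ} (M : Matrix (Fin k) (Fin k) ℝ) (i a : Fin k) :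
    (columnMatrix k).symm M i a = M a i := rfl

theorem gram_eq_transpose_mul {k : ℕ} (B : Fin k → Euc k) :
    Matrix.gram ℝ B = (columnMatrix k B).transpose * columnMatrix k B := by
  ext i j
  simp [Matrix.mul_apply, PiLp.inner_apply, mul_comm]

theorem isUnit_columnMatrix {k : ℕ} {B : Fin k → Euc k} (hB : LinearIndependent ℝ B) :
    IsUnit (columnMatrix k B) := by
  rw [← Matrix.linearIndependent_cols_iff_isUnit]
  exact hB.map' (WithLp.linearEquiv 2 ℝ (Fin k → ℝ)).toLinearMap (LinearEquiv.ker _)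

theorem mem_orthogonalGroup_iff_mul {n R : Type*} [Fintype n] [DecidableEq n] [CommRing R]
    {A M : Matrix n n R} (hM : IsUnit M) :
    A ∈ Matrix.orthogonalGroup n R ↔ (A * M).transpose * (A * M) = M.transpose * M := by
  have hM' : IsUnit M.transpose := (Matrix.isUnit_transpose M).2 hM
  rw [Matrix.mem_orthogonalGroup_iff', Matrix.transpose_mul, Matrix.mul_assoc, hM'.mul_right_inj,
    ← Matrix.mul_assoc, hM.mul_eq_right]

/-- A linearly independent `k`-tuple in `ℝ^k` identifies the `k`-tuples with the same Gram matrix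
with the orthogonal group: `A ∈ O(k)` corresponds to the image of the tuple under `A`. -/
def gramFiberDiffeo {k : ℕ} {B₀ : Fin k → Euc k} (hB₀ : LinearIndependent ℝ B₀) :
    SetDiffeo (gramFiber B₀) (orthogonalMatrices k) :=
  let M := columnMatrix k B₀
  have hM : IsUnit M := isUnit_columnMatrix hB₀
  have hdet : IsUnit M.det := (Matrix.isUnit_iff_isUnit_det M).1 hM
  have hcancel (P : Matrix (Fin k) (Fin k) ℝ) : P * M⁻¹ * M = P :=
    Matrix.nonsing_inv_mul_cancel_right _ _ hdet
  .ofMaps (fun B => Matrix.of.symm (columnMatrix k B * M⁻¹))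
    (fun A => (columnMatrix k).symm (Matrix.of A * M))
    isOpen_univ (Set.subset_univ _)
    (contDiff_pi.2 fun a => contDiff_pi.2 fun i => by
      simp only [Matrix.of_symm_apply, Matrix.mul_apply, columnMatrix_apply]
      fun_prop).contDiffOn
    isOpen_univ (Set.subset_univ _)
    (contDiff_pi.2 fun i => contDiff_euclidean.2 fun a => by
      simp only [columnMatrix_symm_apply, Matrix.mul_apply, Matrix.of_apply]
      fun_prop).contDiffOn
    (fun B hB => by
      rw [orthogonalMatrices, Set.mem_ofPred_eq, Equiv.apply_symm_apply,
        mem_orthogonalGroup_iff_mul hM, hcancel, ← gram_eq_transpose_mul, ← gram_eq_transpose_mul]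
      exact hB)
    (fun A hA => by
      rw [gramFiber, Set.mem_ofPred_eq, gram_eq_transpose_mul, gram_eq_transpose_mul,
        Equiv.apply_symm_apply]
      exact (mem_orthogonalGroup_iff_mul hM).1 hA)
    ⟨fun B _ => by simp only [Equiv.apply_symm_apply, hcancel, Equiv.symm_apply_apply],
      fun A _ => by
        simp only [Equiv.apply_symm_apply, Matrix.mul_nonsing_inv_cancel_right _ _ hdet,
          Equiv.symm_apply_apply]⟩

end Gram

/-! ### Coordinates on compactified configuration spaces -/

section Coordinates

variable {k n : ℕ}

/-- The directions `π_{ij}(u)` as vectors of `ℝ^k`. -/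
def unitDirection (u : Fin n → Euc k) (a : Pairs n) : Euc k :=
  ‖u a.1.1 - u a.1.2‖⁻¹ • (u a.1.1 - u a.1.2)

/-- The ratios of distances `r = r_{ijl}(u)` in the coordinate `r / (1 + r)` of `[0, ∞]`. -/
def distRatio (u : Fin n → Euc k) (s : Triples n) : ℝ :=
  ‖u s.1.1 - u s.1.2.1‖ / (‖u s.1.1 - u s.1.2.1‖ + ‖u s.1.1 - u s.1.2.2‖)

/-- The map `α_n` in the coordinates of the surrounding vector space. -/
def configCoord (u : Fin n → Euc k) : AmbientVec k n := (u, unitDirection u, distRatio u)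

/-- The point of the compactified configuration space, in the surrounding coordinates, that is
given by the configuration `v + t • u`, with the directions and ratios of `u` also for `t = 0`. -/
def blowup (v : Euc k) (t : ℝ) (u : Fin n → Euc k) : AmbientVec k n :=
  (fun i => v + t • u i, unitDirection u, distRatio u)

theorem norm_sub_pos {u : Fin n → Euc k} (hu : Function.Injective u) {i j : Fin n} (hij : i ≠ j) :
    0 < ‖u i - u j‖ :=
  norm_sub_pos_iff.2 (hu.ne hij)

theorem distRatio_mem_Ioo {u : Fin n → Euc k} (hu : Function.Injective u) (s : Triples n) :
    distRatio u s ∈ Set.Ioo 0 1 := by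
  have hij := norm_sub_pos hu s.2.1
  have hil := norm_sub_pos hu s.2.2.2
  exact ⟨by unfold distRatio; positivity, (div_lt_one (by positivity)).2 (by linarith)⟩

theorem one_sub_distRatio_mul {u : Fin n → Euc k} (hu : Function.Injective u) (s : Triples n) :
    (1 - distRatio u s) * ‖u s.1.1 - u s.1.2.1‖ = distRatio u s * ‖u s.1.1 - u s.1.2.2‖ := by
  have hij := norm_sub_pos hu s.2.1
  have hil := norm_sub_pos hu s.2.2.2
  rw [distRatio]
  field_simp
  ring

theorem distRatio_affine (v : Euc k) {t : ℝ} (ht : 0 < t) (u : Fin n → Euc k) :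
    distRatio (fun i => v + t • u i) = distRatio u := by
  ext s
  simp only [distRatio, add_sub_add_left_eq_sub, ← smul_sub, norm_smul, ← mul_add]
  rw [mul_div_mul_left _ _ (norm_ne_zero_iff.2 ht.ne')]

theorem unitDirection_affine (v : Euc k) {t : ℝ} (ht : 0 < t) (u : Fin n → Euc k) :
    unitDirection (fun i => v + t • u i) = unitDirection u := by
  funext a
  simp only [unitDirection, add_sub_add_left_eq_sub, ← smul_sub, norm_smul, mul_inv, smul_smul,
    Real.norm_of_nonneg ht.le]
  rw [mul_right_comm, inv_mul_cancel₀ ht.ne', one_mul]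

theorem configCoord_affine (v : Euc k) {t : ℝ} (ht : 0 < t) (u : Fin n → Euc k) :
    configCoord (fun i => v + t • u i) = blowup v t u := by
  rw [configCoord, unitDirection_affine v ht, distRatio_affine v ht, blowup]

theorem configCoord_eq_blowup (u : Fin n → Euc k) : configCoord u = blowup 0 1 u := by
  simp [configCoord, blowup]

theorem injective_affine (v : Euc k) {t : ℝ} (ht : 0 < t) {u : Fin n → Euc k}
    (hu : Function.Injective u) : Function.Injective fun i => v + t • u i :=
  (add_right_injective v).comp ((smul_right_injective _ ht.ne').comp hu)

theorem blowup_mem_closure {A : Set (Fin n → Euc k)} (v : Euc k) {t : ℝ} (ht : 0 ≤ t)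
    {u : Fin n → Euc k} (hA : ∀ s : ℝ, 0 < s → (fun i => v + s • u i) ∈ A) :
    blowup v t u ∈ closure (configCoord '' A) := by
  have hcont : Continuous fun s : ℝ => blowup v s u := by
    unfold blowup
    fun_prop
  exact hcont.continuousWithinAt.mem_closure (s := Set.Ioi 0) (by simpa using ht)
    fun s hs => ⟨_, hA s hs, configCoord_affine v hs u⟩

theorem contDiffOn_blowup : ContDiffOn ℝ ∞
    (fun x : (Fin n → Euc k) × ℝ × Euc k => blowup x.2.2 x.2.1 x.1)
    {x | Function.Injective x.1} := by
  intro x hx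
  have hsub (i j : Fin n) :
      ContDiffAt ℝ ∞ (fun x : (Fin n → Euc k) × ℝ × Euc k => x.1 i - x.1 j) x := by fun_prop
  have hnorm {i j : Fin n} (hij : i ≠ j) :
      ContDiffAt ℝ ∞ (fun x : (Fin n → Euc k) × ℝ × Euc k => ‖x.1 i - x.1 j‖) x :=
    (hsub i j).norm ℝ (norm_pos_iff.1 (norm_sub_pos hx hij))
  refine ContDiffAt.contDiffWithinAt (.prodMk (contDiffAt_pi.2 fun i => by fun_prop)
    (.prodMk (contDiffAt_pi.2 fun a => ?_) (contDiffAt_pi.2 fun s => ?_)))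
  · exact ((hnorm a.2).inv (norm_sub_pos hx a.2).ne').smul (hsub _ _)
  · exact (hnorm s.2.1).div ((hnorm s.2.1).add (hnorm s.2.2.2))
      (add_pos (norm_sub_pos hx s.2.1) (norm_sub_pos hx s.2.2.2)).ne'

/-- The points whose ratio coordinates all lie in `(0, 1)`, that is, whose ratios of distances are
neither `0` nor `∞`. -/
def finiteRatios (k n : ℕ) : Set (AmbientVec k n) := {z | ∀ s, z.2.2 s ∈ Set.Ioo 0 1}

theorem isOpen_finiteRatios : IsOpen (finiteRatios k n) := by
  simp only [finiteRatios, Set.ofPred_forall]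
  exact isOpen_iInter_of_finite fun s => isOpen_Ioo.preimage (by fun_prop)

theorem orderIsoUnitIntervalBirational_ofReal_div {a b : ℝ} (ha : 0 < a) (hb : 0 < b) :
    (ENNReal.orderIsoUnitIntervalBirational (ENNReal.ofReal (a / b)) : ℝ) = a / (a + b) := by
  have hab : 0 < a / b := div_pos ha hb
  rw [ENNReal.orderIsoUnitIntervalBirational_apply_coe, ENNReal.toReal_inv,
    ENNReal.toReal_add (by simpa using hab) (by simp), ENNReal.toReal_inv,
    ENNReal.toReal_ofReal hab.le, ENNReal.toReal_one]
  field_simp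
  ring

theorem orderIsoUnitIntervalBirational_ratio (p : Config k n) (s : Triples n) :
    (ENNReal.orderIsoUnitIntervalBirational (ratio p s) : ℝ) = distRatio p.1 s :=
  orderIsoUnitIntervalBirational_ofReal_div (norm_sub_pos p.2 s.2.1) (norm_sub_pos p.2 s.2.2.2)

theorem ambientCoord_alpha (p : Config k n) : ambientCoord (alpha p) = configCoord p.1 :=
  Prod.ext rfl (Prod.ext rfl (funext (orderIsoUnitIntervalBirational_ratio p)))

theorem ratio_eq_iff {p q : Config k n} {s : Triples n} :
    ratio p s = ratio q s ↔ distRatio p.1 s = distRatio q.1 s := by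
  rw [← orderIsoUnitIntervalBirational_ratio, ← orderIsoUnitIntervalBirational_ratio,
    Subtype.coe_inj, EmbeddingLike.apply_eq_iff_eq]

theorem isClosedEmbedding_ambientCoord :
    Topology.IsClosedEmbedding (ambientCoord (k := k) (n := n)) := by
  have hsphere : Topology.IsClosedEmbedding ((↑) : Metric.sphere (0 : Euc k) 1 → Euc k) :=
    Metric.isClosed_sphere.isClosedEmbedding_subtypeVal
  have hratio : Topology.IsClosedEmbedding
      fun r : ℝ≥0∞ => (ENNReal.orderIsoUnitIntervalBirational r : ℝ) :=
    isClosed_Icc.isClosedEmbedding_subtypeVal.comp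
      ENNReal.orderIsoUnitIntervalBirational.toHomeomorph.isClosedEmbedding
  exact .prodMap .id (.prodMap (.piMap fun _ => hsphere) (.piMap fun _ => hratio))

theorem ambientCoord_image_closure_alpha (A : Set (Config k n)) :
    ambientCoord '' closure (alpha '' A) = closure (configCoord '' (Subtype.val '' A)) := by
  rw [← isClosedEmbedding_ambientCoord.closure_image_eq, Set.image_image, Set.image_image]
  simp only [ambientCoord_alpha]

/-- The compactified configuration space in the coordinates of the surrounding vector space. -/
def compactCoord (k n : ℕ) : Set (AmbientVec k n) :=
  closure (configCoord '' {u | Function.Injective u})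

theorem ambientCoord_image_compactConfig :
    ambientCoord '' compactConfig k n = compactCoord k n := by
  rw [compactConfig, compactCoord, ← Set.image_univ, ambientCoord_image_closure_alpha,
    Set.image_univ, Subtype.range_coe_subtype]

/-- The configurations with the same ratios of distances as `u₀`. -/
def similarConfigs (u₀ : Fin n → Euc k) : Set (Fin n → Euc k) :=
  {u | Function.Injective u ∧ distRatio u = distRatio u₀}

theorem ambientCoord_image_simClosure (Δ : Affine.Simplex ℝ (Euc k) k) :
    ambientCoord '' simClosure Δ = closure (configCoord '' similarConfigs Δ.points) := by
  rw [simClosure, ambientCoord_image_closure_alpha]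
  have hiff (q : Config k (k + 1)) : q ∈ Sim Δ ↔ distRatio q.1 = distRatio Δ.points := by
    rw [funext_iff]
    exact forall_congr' fun s => ratio_eq_iff
  congr! 2
  ext u
  simp only [Set.mem_image, hiff, Subtype.exists, exists_and_left, exists_prop,
    exists_eq_right_right, similarConfigs, Set.mem_ofPred_eq]
  exact and_comm

theorem norm_sub_eq_of_distRatio_eq {u u' : Fin n → Euc k} (hu : Function.Injective u)
    (hu' : Function.Injective u') (h : distRatio u = distRatio u') {i₀ i₁ : Fin n} (h01 : i₀ ≠ i₁)
    (hnorm : ‖u i₀ - u i₁‖ = ‖u' i₀ - u' i₁‖) (i j : Fin n) : ‖u i - u j‖ = ‖u' i - u' j‖ := by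
  have hcompare {i j l : Fin n} (hil : i ≠ l) (heq : ‖u i - u l‖ = ‖u' i - u' l‖) :
      ‖u i - u j‖ = ‖u' i - u' j‖ := by
    rcases eq_or_ne i j with rfl | hij
    · simp
    rcases eq_or_ne j l with rfl | hjl
    · exact heq
    let s : Triples n := ⟨(i, j, l), hij, hjl, hil⟩
    have hs : 1 - distRatio u s ≠ 0 := (sub_pos.2 (distRatio_mem_Ioo hu s).2).ne'
    refine mul_left_cancel₀ hs ?_
    rw [one_sub_distRatio_mul hu s, h, one_sub_distRatio_mul hu' s]
    exact congrArg _ heq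
  rcases eq_or_ne i i₀ with rfl | hi
  · exact hcompare h01 hnorm
  · refine hcompare hi ?_
    rw [norm_sub_rev, hcompare h01 hnorm, norm_sub_rev]

theorem eqOn_compactCoord {Y : Type*} [TopologicalSpace Y] [T2Space Y] {f g : AmbientVec k n → Y}
    (hf : ContinuousOn f (compactCoord k n ∩ finiteRatios k n))
    (hg : ContinuousOn g (compactCoord k n ∩ finiteRatios k n))
    (h : ∀ u, Function.Injective u → f (configCoord u) = g (configCoord u)) :
    Set.EqOn f g (compactCoord k n ∩ finiteRatios k n) := by
  refine Set.EqOn.of_subset_closure (s := configCoord '' {u | Function.Injective u}) ?_ hf hg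
    (fun z hz => ⟨subset_closure hz, ?_⟩) Set.inter_subset_left
  · rintro _ ⟨u, hu, rfl⟩
    exact h u hu
  · obtain ⟨u, hu, rfl⟩ := hz
    exact distRatio_mem_Ioo hu

end Coordinates

section Cone

variable {V : Type*} {n : ℕ}

/-- The configuration with first point `0` and remaining points `B`. -/
def cone [Zero V] (B : Fin n → V) : Fin (n + 1) → V := Fin.cons 0 B

@[simp]
theorem cone_zero [Zero V] (B : Fin n → V) : cone B 0 = 0 := rfl

@[simp]
theorem cone_succ [Zero V] (B : Fin n → V) (i : Fin n) : cone B i.succ = B i := rfl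

theorem cone_one [Zero V] [NeZero n] (B : Fin n → V) : cone B 1 = B 0 := by
  rw [← Fin.succ_zero_eq_one', cone_succ]

theorem continuous_cone [Zero V] [TopologicalSpace V] : Continuous (cone : (Fin n → V) → _) :=
  continuous_pi (Fin.cases continuous_const continuous_apply)

theorem isOpen_injective_cone [Zero V] [TopologicalSpace V] [T2Space V] :
    IsOpen {B : Fin n → V | Function.Injective (cone B)} := by
  have hpairs : {B : Fin n → V | Function.Injective (cone B)} =
      ⋂ a : Pairs (n + 1), {B | cone B a.1.1 ≠ cone B a.1.2} := by
    ext B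
    simp only [Set.mem_ofPred_eq, Set.mem_iInter]
    exact ⟨fun h a e => a.2 (h e), fun h i j e => by_contra fun hij => h ⟨(i, j), hij⟩ e⟩
  rw [hpairs]
  exact isOpen_iInter_of_finite fun a =>
    isOpen_ne_fun ((continuous_apply _).comp continuous_cone)
      ((continuous_apply _).comp continuous_cone)

theorem contDiff_cone [NormedAddCommGroup V] [NormedSpace ℝ V] {m : WithTop ℕ∞} :
    ContDiff ℝ m (cone : (Fin n → V) → _) :=
  contDiff_pi.2 (Fin.cases contDiff_const (contDiff_apply ℝ V))

theorem mem_gramFiber_iff_norm_cone_sub [NormedAddCommGroup V] [InnerProductSpace ℝ V]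
    {B B₀ : Fin n → V} :
    B ∈ gramFiber B₀ ↔ ∀ i j, ‖cone B i - cone B j‖ = ‖cone B₀ i - cone B₀ j‖ := by
  rw [mem_gramFiber]
  constructor
  · intro h
    have hinner (i j : Fin (n + 1)) :
        inner ℝ (cone B i) (cone B j) = inner ℝ (cone B₀ i) (cone B₀ j) := by
      cases i using Fin.cases <;> cases j using Fin.cases <;> simp [h]
    intro i j
    rw [← sq_eq_sq₀ (norm_nonneg _) (norm_nonneg _)]
    simp only [← real_inner_self_eq_norm_sq, inner_sub_left, inner_sub_right, hinner]
  · intro h i j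
    have hnorm (i : Fin n) : ‖B i‖ = ‖B₀ i‖ := by simpa using h i.succ 0
    have hsub : ‖B i - B j‖ = ‖B₀ i - B₀ j‖ := h i.succ j.succ
    simp only [real_inner_eq_norm_mul_self_add_norm_mul_self_sub_norm_sub_mul_self_div_two, hnorm,
      hsub]

variable [NormedAddCommGroup V] [NormedSpace ℝ V]

/-- The edge vectors of a configuration at its first point, rescaled so that the first of them has
length `1`. -/
def edgeVectors (u : Fin (n + 1) → V) (i : Fin n) : V :=
  ‖u 1 - u 0‖⁻¹ • (u i.succ - u 0)

variable {u : Fin (n + 1) → V}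

theorem add_norm_smul_cone_edgeVectors (hu : u 1 ≠ u 0) :
    (fun i => u 0 + ‖u 1 - u 0‖ • cone (edgeVectors u) i) = u := by
  have h : ‖u 1 - u 0‖ ≠ 0 := norm_ne_zero_iff.2 (sub_ne_zero.2 hu)
  funext i
  cases i using Fin.cases <;> simp [edgeVectors, smul_smul, h]

variable [NeZero n]

theorem edgeVectors_cone {B : Fin n → V} (hB : ‖B 0‖ = 1) : edgeVectors (cone B) = B := by
  funext i
  simp [edgeVectors, cone_one, hB]

theorem norm_edgeVectors_zero (hu : u 1 ≠ u 0) : ‖edgeVectors u 0‖ = 1 := by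
  rw [edgeVectors, Fin.succ_zero_eq_one']
  exact norm_smul_inv_norm (𝕜 := ℝ) (sub_ne_zero.2 hu)

theorem linearIndependent_edgeVectors (hu : AffineIndependent ℝ u) :
    LinearIndependent ℝ (edgeVectors u) := by
  have hne : ‖u 1 - u 0‖⁻¹ ≠ 0 :=
    inv_ne_zero (norm_ne_zero_iff.2 (sub_ne_zero.2 (hu.injective.ne one_ne_zero)))
  exact (((affineIndependent_iff_linearIndependent_vsub ℝ u 0).1 hu).comp
    (fun i : Fin n => ⟨i.succ, Fin.succ_ne_zero i⟩)
    fun i j h => Fin.succ_injective n (congrArg Subtype.val h)).units_smul fun _ => Units.mk0 _ hne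

end Cone

/-! ### The chart at a collision of all points -/

section CollisionChart

variable {k n : ℕ}

/-- The chart of the compactified configuration space near a collision of all points, where the
coordinate `t` is the distance of the first two points. -/
def collisionPoint (y : (Fin n → Euc k) × ℝ × Euc k) : AmbientVec k (n + 1) :=
  blowup y.2.2 y.2.1 (cone y.1)

theorem contDiffOn_collisionPoint :
    ContDiffOn ℝ ∞ (collisionPoint (k := k) (n := n)) {y | Function.Injective (cone y.1)} :=
  contDiffOn_blowup.comp
    (f := fun y : (Fin n → Euc k) × ℝ × Euc k => ((cone y.1, y.2) : (Fin (n + 1) → Euc k) × _))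
    ((contDiff_cone.comp contDiff_fst).prodMk contDiff_snd).contDiffOn fun _ hy => hy

theorem collisionPoint_mem {y : (Fin n → Euc k) × ℝ × Euc k} (hinj : Function.Injective (cone y.1))
    (ht : 0 ≤ y.2.1) : collisionPoint y ∈ compactCoord k (n + 1) ∩ finiteRatios k (n + 1) :=
  ⟨blowup_mem_closure _ ht fun _ hs => injective_affine _ hs hinj, distRatio_mem_Ioo hinj⟩

variable [NeZero n]

/-- The edge vectors of the configurations whose first two points have distance `1`. -/
def normalizedEdges (k n : ℕ) [NeZero n] : Set (Fin n → Euc k) :=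
  {B | ‖B 0‖ = 1} ∩ {B | Function.Injective (cone B)}

/-- The pair `(i + 1, 0)`. -/
def edgePair (i : Fin n) : Pairs (n + 1) := ⟨(i.succ, 0), Fin.succ_ne_zero i⟩

/-- The triple `(0, i + 1, 1)`. -/
def edgeTriple (i : Fin n) (hi : i ≠ 0) : Triples (n + 1) :=
  ⟨(0, i.succ, 1), (Fin.succ_ne_zero i).symm,
    fun h => hi (Fin.succ_injective _ (h.trans Fin.succ_zero_eq_one'.symm)), zero_ne_one⟩

/-- The distance of the first two points. It is defined without the norm so that it is smooth where
the two points collide. -/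
def scale (z : AmbientVec k (n + 1)) : ℝ :=
  inner ℝ (z.1 1 - z.1 0) (z.2.1 (edgePair 0))

/-- The rescaled edge vectors of `edgeVectors` in terms of directions and ratios of distances only.
They are thus also defined where the points of the configuration collide. -/
def edges (z : AmbientVec k (n + 1)) (i : Fin n) : Euc k :=
  if hi : i = 0 then z.2.1 (edgePair i)
  else (z.2.2 (edgeTriple i hi) / (1 - z.2.2 (edgeTriple i hi))) • z.2.1 (edgePair i)

theorem contDiff_scale {m : WithTop ℕ∞} : ContDiff ℝ m (scale (k := k) (n := n)) :=
  ContDiff.inner ℝ (by fun_prop) (by fun_prop)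

theorem contDiffOn_edges {m : WithTop ℕ∞} :
    ContDiffOn ℝ m (edges (k := k)) (finiteRatios k (n + 1)) := by
  refine contDiffOn_pi.2 fun i => ?_
  unfold edges
  split_ifs with hi
  · fun_prop
  · have hratio : ContDiff ℝ m fun z : AmbientVec k (n + 1) => z.2.2 (edgeTriple i hi) := by
      fun_prop
    refine (hratio.contDiffOn.div (contDiff_const.sub hratio).contDiffOn fun z hz => ?_).smul
      (by fun_prop)
    exact (sub_pos.2 (hz _).2).ne'

theorem scale_blowup (v : Euc k) (t : ℝ) (u : Fin (n + 1) → Euc k) :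
    scale (blowup v t u) = t * ‖u 1 - u 0‖ := by
  simp only [scale, blowup, unitDirection, edgePair, Fin.succ_zero_eq_one',
    add_sub_add_left_eq_sub, ← smul_sub, real_inner_smul_left, real_inner_smul_right,
    real_inner_self_eq_norm_mul_norm]
  rcases eq_or_ne ‖u 1 - u 0‖ 0 with h | h
  · simp [h]
  · field_simp

theorem edges_blowup (v : Euc k) (t : ℝ) {u : Fin (n + 1) → Euc k} (hu : Function.Injective u) :
    edges (blowup v t u) = edgeVectors u := by
  funext i
  by_cases hi : i = 0
  · simp only [edges, hi, dite_true, blowup, unitDirection, edgePair, edgeVectors,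
      Fin.succ_zero_eq_one']
  · have hr := one_sub_distRatio_mul hu (edgeTriple i hi)
    have hr1 : 1 - distRatio u (edgeTriple i hi) ≠ 0 :=
      (sub_pos.2 (distRatio_mem_Ioo hu (edgeTriple i hi)).2).ne'
    have h1 := (norm_sub_pos hu one_ne_zero).ne'
    have hi' := (norm_sub_pos hu (Fin.succ_ne_zero i)).ne'
    simp only [edgeTriple, norm_sub_rev (u 0)] at hr hr1
    simp only [edges, hi, dite_false, blowup, unitDirection, edgePair, edgeTriple, edgeVectors,
      smul_smul]
    congr 1
    field_simp
    linarith

theorem edges_configCoord {u : Fin (n + 1) → Euc k} (hu : Function.Injective u) :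
    edges (configCoord u) = edgeVectors u := by
  rw [configCoord_eq_blowup, edges_blowup _ _ hu]

theorem configCoord_eq_blowup_cone {u : Fin (n + 1) → Euc k} (hu : Function.Injective u) :
    configCoord u = blowup (u 0) ‖u 1 - u 0‖ (cone (edgeVectors u)) := by
  rw [← configCoord_affine _ (norm_sub_pos hu one_ne_zero),
    add_norm_smul_cone_edgeVectors (hu.ne one_ne_zero)]

theorem distRatio_cone_edgeVectors {u : Fin (n + 1) → Euc k} (hu : Function.Injective u) :
    distRatio (cone (edgeVectors u)) = distRatio u :=
  congrArg (fun z => z.2.2) (configCoord_eq_blowup_cone hu).symm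

theorem edgeVectors_mem_normalizedEdges {u : Fin (n + 1) → Euc k} (hu : Function.Injective u) :
    edgeVectors u ∈ normalizedEdges k n := by
  have hne := hu.ne one_ne_zero
  refine ⟨norm_edgeVectors_zero hne, ?_⟩
  rw [← add_norm_smul_cone_edgeVectors hne] at hu
  exact Function.Injective.of_comp (f := fun x => u 0 + ‖u 1 - u 0‖ • x) hu

/-- The inverse of `collisionPoint`. -/
def collisionCoord (z : AmbientVec k (n + 1)) : (Fin n → Euc k) × ℝ × Euc k :=
  (edges z, scale z, z.1 0)

theorem contDiffOn_collisionCoord :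
    ContDiffOn ℝ ∞ (collisionCoord (k := k) (n := n)) (finiteRatios k (n + 1)) :=
  contDiffOn_edges.prodMk (contDiff_scale.contDiffOn.prodMk (by fun_prop))

theorem collisionCoord_collisionPoint {y : (Fin n → Euc k) × ℝ × Euc k}
    (hy : y.1 ∈ normalizedEdges k n) : collisionCoord (collisionPoint y) = y := by
  obtain ⟨B, t, v⟩ := y
  obtain ⟨hnorm, hinj⟩ : ‖B 0‖ = 1 ∧ Function.Injective (cone B) := hy
  simp only [collisionCoord, collisionPoint, edges_blowup v t hinj, edgeVectors_cone hnorm,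
    scale_blowup, cone_one, cone_zero, sub_zero, hnorm, mul_one]
  simp [blowup]

theorem collisionPoint_collisionCoord_configCoord {u : Fin (n + 1) → Euc k}
    (hu : Function.Injective u) :
    collisionPoint (collisionCoord (configCoord u)) = configCoord u := by
  rw [configCoord_eq_blowup_cone hu]
  exact congrArg collisionPoint
    (collisionCoord_collisionPoint (y := (_, _, _)) (edgeVectors_mem_normalizedEdges hu))

theorem continuousOn_edges_compactCoord :
    ContinuousOn (edges (k := k)) (compactCoord k (n + 1) ∩ finiteRatios k (n + 1)) :=
  (contDiffOn_edges (m := 0)).continuousOn.mono Set.inter_subset_right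

variable {z : AmbientVec k (n + 1)}

theorem scale_nonneg (hz : z ∈ compactCoord k (n + 1)) : 0 ≤ scale z := by
  refine closure_minimal (t := {z | 0 ≤ scale z}) ?_
    (isClosed_le continuous_const (contDiff_scale (m := 0)).continuous) hz
  rintro _ ⟨u, -, rfl⟩
  rw [configCoord_eq_blowup, Set.mem_ofPred_eq, scale_blowup]
  positivity

theorem norm_edges_zero (hz : z ∈ compactCoord k (n + 1) ∩ finiteRatios k (n + 1)) :
    ‖edges z 0‖ = 1 := by
  refine eqOn_compactCoord (f := fun z => ‖edges z 0‖) (g := fun _ => 1)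
    (continuousOn_pi.1 continuousOn_edges_compactCoord 0).norm continuousOn_const
    (fun u hu => ?_) hz
  rw [edges_configCoord hu]
  exact norm_edgeVectors_zero (hu.ne one_ne_zero)

theorem one_sub_ratio_mul_norm_cone_edges
    (hz : z ∈ compactCoord k (n + 1) ∩ finiteRatios k (n + 1)) (s : Triples (n + 1)) :
    (1 - z.2.2 s) * ‖cone (edges z) s.1.1 - cone (edges z) s.1.2.1‖ =
      z.2.2 s * ‖cone (edges z) s.1.1 - cone (edges z) s.1.2.2‖ := by
  have hcone (i : Fin (n + 1)) : ContinuousOn (fun z : AmbientVec k (n + 1) => cone (edges z) i)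
      (compactCoord k (n + 1) ∩ finiteRatios k (n + 1)) :=
    continuousOn_pi.1 (continuous_cone.comp_continuousOn continuousOn_edges_compactCoord) i
  have hratio : Continuous fun z : AmbientVec k (n + 1) => z.2.2 s := by fun_prop
  refine eqOn_compactCoord
    ((continuous_const.sub hratio).continuousOn.mul ((hcone s.1.1).sub (hcone s.1.2.1)).norm)
    (hratio.continuousOn.mul ((hcone s.1.1).sub (hcone s.1.2.2)).norm) (fun u hu => ?_) hz
  have h := one_sub_distRatio_mul (edgeVectors_mem_normalizedEdges hu).2 s
  rwa [distRatio_cone_edgeVectors hu, ← edges_configCoord hu] at h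

theorem injective_cone_edges (hz : z ∈ compactCoord k (n + 1) ∩ finiteRatios k (n + 1)) :
    Function.Injective (cone (edges z)) := by
  -- If two of the points were equal, then so would be all of them.
  intro i j hij
  by_contra hne
  have hall (l : Fin (n + 1)) : cone (edges z) i = cone (edges z) l := by
    rcases eq_or_ne i l with rfl | hil
    · rfl
    rcases eq_or_ne j l with rfl | hjl
    · exact hij
    have h := one_sub_ratio_mul_norm_cone_edges hz ⟨(i, j, l), hne, hjl, hil⟩
    rw [hij, sub_self, norm_zero, mul_zero, ← hij] at h
    exact sub_eq_zero.1 (norm_eq_zero.1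
      ((mul_eq_zero.1 h.symm).resolve_left (hz.2 ⟨(i, j, l), hne, hjl, hil⟩).1.ne'))
  have h1 : edges z 0 = 0 := by
    rw [← cone_one (edges z), ← hall 1, hall 0, cone_zero]
  simpa [h1] using norm_edges_zero hz

theorem edges_mem_normalizedEdges (hz : z ∈ compactCoord k (n + 1) ∩ finiteRatios k (n + 1)) :
    edges z ∈ normalizedEdges k n :=
  ⟨norm_edges_zero hz, injective_cone_edges hz⟩

theorem collisionPoint_collisionCoord (hz : z ∈ compactCoord k (n + 1) ∩ finiteRatios k (n + 1)) :
    collisionPoint (collisionCoord z) = z := by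
  refine eqOn_compactCoord (f := collisionPoint ∘ collisionCoord) (g := id) ?_ continuousOn_id
    (fun u hu => collisionPoint_collisionCoord_configCoord hu) hz
  exact contDiffOn_collisionPoint.continuousOn.comp
    (contDiffOn_collisionCoord.continuousOn.mono Set.inter_subset_right)
    fun z hz => injective_cone_edges hz

/-- The part of the compactified configuration space with finite ratios of distances is a manifold
with boundary, in the coordinates `collisionCoord`. -/
def collisionChart (k n : ℕ) [NeZero n] :
    SetDiffeo (compactCoord k (n + 1) ∩ finiteRatios k (n + 1))
      (normalizedEdges k n ×ˢ (Set.Ici (0 : ℝ) ×ˢ (Set.univ : Set (Euc k)))) :=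
  .ofMaps collisionCoord collisionPoint isOpen_finiteRatios Set.inter_subset_right
    contDiffOn_collisionCoord (isOpen_injective_cone.preimage continuous_fst)
    (fun _ hy => hy.1.2) contDiffOn_collisionPoint
    (fun _ hz => ⟨edges_mem_normalizedEdges hz, scale_nonneg hz.1, trivial⟩)
    (fun _ hy => collisionPoint_mem hy.1.2 hy.2.1)
    ⟨fun _ hz => collisionPoint_collisionCoord hz, fun _ hy => collisionCoord_collisionPoint hy.1⟩

end CollisionChart

/-! ### Configurations similar to a given one -/

section Similar

variable {k n : ℕ} [NeZero n] {u₀ : Fin (n + 1) → Euc k}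

theorem closure_similarConfigs (hu₀ : Function.Injective u₀) :
    closure (configCoord '' similarConfigs u₀) =
      {z ∈ compactCoord k (n + 1) | z.2.2 = distRatio u₀} := by
  refine (closure_minimal ?_ ?_).antisymm ?_
  · rintro _ ⟨u, ⟨hu, hratio⟩, rfl⟩
    exact ⟨subset_closure ⟨u, hu, rfl⟩, hratio⟩
  · exact isClosed_closure.inter (isClosed_eq (by fun_prop) continuous_const)
  · rintro z ⟨hz, hratio⟩
    have hzF : z ∈ compactCoord k (n + 1) ∩ finiteRatios k (n + 1) :=
      ⟨hz, fun s => hratio ▸ distRatio_mem_Ioo hu₀ s⟩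
    have hcone : distRatio (cone (edges z)) = distRatio u₀ := by
      rw [← hratio]
      exact congrArg (fun z => z.2.2) (collisionPoint_collisionCoord hzF)
    rw [← collisionPoint_collisionCoord hzF]
    refine blowup_mem_closure _ (scale_nonneg hz) fun s hs =>
      ⟨injective_affine _ hs (injective_cone_edges hzF), ?_⟩
    rw [distRatio_affine _ hs]
    exact hcone

theorem gramFiber_subset_normalizedEdges {B₀ : Fin n → Euc k} (hB₀ : B₀ ∈ normalizedEdges k n) :
    gramFiber B₀ ⊆ normalizedEdges k n := by
  intro B hB
  refine ⟨(norm_eq_of_mem_gramFiber hB 0).trans hB₀.1, fun i j hij => hB₀.2 ?_⟩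
  rw [← sub_eq_zero, ← norm_eq_zero, ← mem_gramFiber_iff_norm_cone_sub.1 hB, hij, sub_self,
    norm_zero]

theorem distRatio_cone_eq_iff {B B₀ : Fin n → Euc k} (hB : B ∈ normalizedEdges k n)
    (hB₀ : B₀ ∈ normalizedEdges k n) :
    distRatio (cone B) = distRatio (cone B₀) ↔ B ∈ gramFiber B₀ := by
  rw [mem_gramFiber_iff_norm_cone_sub]
  refine ⟨fun h => norm_sub_eq_of_distRatio_eq hB.2 hB₀.2 h one_ne_zero ?_, fun h => ?_⟩
  · rw [cone_one, cone_one, cone_zero, cone_zero, sub_zero, sub_zero]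
    exact hB.1.trans hB₀.1.symm
  · funext s
    simp only [distRatio, h]

theorem closure_similarConfigs_subset (hu₀ : Function.Injective u₀) :
    closure (configCoord '' similarConfigs u₀) ⊆
      compactCoord k (n + 1) ∩ finiteRatios k (n + 1) := by
  rw [closure_similarConfigs hu₀]
  exact fun z hz => ⟨hz.1, fun s => hz.2 ▸ distRatio_mem_Ioo hu₀ s⟩

theorem mem_closure_similarConfigs_iff (hu₀ : Function.Injective u₀)
    (z : (compactCoord k (n + 1) ∩ finiteRatios k (n + 1) : Set (AmbientVec k (n + 1)))) :
    (z : AmbientVec k (n + 1)) ∈ closure (configCoord '' similarConfigs u₀) ↔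
      ((collisionChart k n).toEquiv z : (Fin n → Euc k) × ℝ × Euc k) ∈
        gramFiber (edgeVectors u₀) ×ˢ (Set.Ici (0 : ℝ) ×ˢ (Set.univ : Set (Euc k))) := by
  have hratio : distRatio (cone (edges z.1)) = z.1.2.2 :=
    congrArg (fun z => z.2.2) (collisionPoint_collisionCoord z.2)
  have hscale : scale z.1 ∈ Set.Ici (0 : ℝ) := scale_nonneg z.2.1
  rw [closure_similarConfigs hu₀, Set.mem_ofPred_eq, ← hratio, ← distRatio_cone_edgeVectors hu₀,
    distRatio_cone_eq_iff (edges_mem_normalizedEdges z.2) (edgeVectors_mem_normalizedEdges hu₀)]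
  exact ⟨fun h => ⟨h.2, hscale, trivial⟩, fun h => ⟨z.2.1, h.1⟩⟩

theorem isSubmanifold_closure_similarConfigs [NeZero k] {u₀ : Fin (k + 1) → Euc k}
    (hu₀ : AffineIndependent ℝ u₀) :
    IsSubmanifold (k * (k + 1)) (k.choose 2 + 1 + k) (compactCoord k (k + 1))
      (closure (configCoord '' similarConfigs u₀)) := by
  obtain ⟨hnorm, hinj⟩ := edgeVectors_mem_normalizedEdges hu₀.injective
  have hgram := isSubmanifold_gramFiber (linearIndependent_edgeVectors hu₀) (by simp) 0
    isOpen_injective_cone fun B hB => (gramFiber_subset_normalizedEdges ⟨hnorm, hinj⟩ hB).2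
  rw [hnorm] at hgram
  have hprod := hgram.prod (.prod .Ici_zero (.univ (E := Euc k)))
  have hdim : k * k - 1 + (1 + k) = k * (k + 1) := by
    have := Nat.mul_pos (NeZero.pos k) (NeZero.pos k)
    rw [Nat.mul_succ]
    omega
  rw [Fintype.card_fin, finrank_euclideanSpace_fin, hdim, ← add_assoc] at hprod
  exact .of_inter_isOpen isOpen_finiteRatios
    ((closure_similarConfigs_subset hu₀.injective).trans Set.inter_subset_right)
    (hprod.of_setDiffeo (collisionChart k k) (closure_similarConfigs_subset hu₀.injective)
      (mem_closure_similarConfigs_iff hu₀.injective))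

/-- The closure of the simplices similar to a given one, in terms of the linear map that sends the
edge vectors of the given simplex to those of a similar one, its scale, and its first vertex. -/
def closureSimilarConfigsDiffeo [NeZero k] {u₀ : Fin (k + 1) → Euc k}
    (hu₀ : AffineIndependent ℝ u₀) :
    SetDiffeo (closure (configCoord '' similarConfigs u₀))
      (orthogonalMatrices k ×ˢ (Set.Ici (0 : ℝ) ×ˢ (Set.univ : Set (Euc k)))) :=
  ((collisionChart k k).restrict (closure_similarConfigs_subset hu₀.injective)
    (Set.prod_mono_left (gramFiber_subset_normalizedEdges
      (edgeVectors_mem_normalizedEdges hu₀.injective)))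
    (mem_closure_similarConfigs_iff hu₀.injective)).trans
  ((gramFiberDiffeo (linearIndependent_edgeVectors hu₀)).prodCongr (.refl _))

end Similar

end SimplexConfig

end

theorem mainTheorem6 (k : ℕ) (hk : 1 ≤ k)
    (Δ : Affine.Simplex ℝ (EuclideanSpace ℝ (Fin k)) k) :
    SimplexConfig.IsSubmanifold (k * (k + 1)) (k.choose 2 + 1 + k)
        (SimplexConfig.ambientCoord '' SimplexConfig.compactConfig k (k + 1))
        (SimplexConfig.ambientCoord '' SimplexConfig.simClosure Δ) ∧
      Nonempty (SimplexConfig.SetDiffeo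
        (SimplexConfig.ambientCoord '' SimplexConfig.simClosure Δ)
        (SimplexConfig.orthogonalMatrices k ×ˢ
          (Set.Ici (0 : ℝ) ×ˢ (Set.univ : Set (EuclideanSpace ℝ (Fin k)))))) := by
  have : NeZero k := ⟨by omega⟩
  rw [SimplexConfig.ambientCoord_image_compactConfig, SimplexConfig.ambientCoord_image_simClosure]
  exact ⟨SimplexConfig.isSubmanifold_closure_similarConfigs Δ.independent,
    ⟨SimplexConfig.closureSimilarConfigsDiffeo Δ.independent⟩⟩
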